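/- Let $X$ be a finite set, let $p^T$ be a probability distribution on $\{0,1\}\times X$ (the target task), and let $\Theta$ be a non-empty set. Fix a finite-dimensional Hilbert space and, for all $\theta\in\Theta$ and $x\in X$, a density matrix $\rho_\theta(x)$ on it. Let $\mathcal M$ be the set of binary POVMs $M=\{M_0,M_1\}$, $M_c\ge 0$, $M_0+M_1=I$, and let $\ell_{\theta,M}(c,x)=1-\mathrm{Tr}(M_c\rho_\theta(x))$. Write $$R_{\theta,M}=\mathbb E_{(c,x)\sim p^T}[\ell_{\theta,M}(c,x)],\qquad R_\theta=\min_{M\in\mathcal M}R_{\theta,M}.$$ Let $N\ge 1$ (denoted $N^T$ for the target task) and let $\mathcal D=\{(c_1,x_1),\dots,(c_N,x_N)\}$ be drawn i.i.d. from $p^T$, with training loss $\widehat R_{\theta,M}=\frac1N\sum_{j=1}^N\ell_{\theta,M}(c_j,x_j)$. With $\sigma_1,\dots,\sigma_N$ i.i.d. uniform on $\{+1,-1\}$, independent of $\mathcal D$, define $$\mathfrak R^T_{\mathcal M}=\sup_{\theta\in\Theta}\mathbb E_{\mathcal D}\,\mathbb E_\sigma\Big[\sup_{M\in\mathcal M}\sum_{j=1}^N\frac{\sigma_j\ell_{\theta,M}(c_j,x_j)}{\sqrt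 N}\Big],\qquad \mathfrak R^T_{\Theta,\mathcal M}=\mathbb E_{\mathcal D}\,\mathbb E_\sigma\Big[\sup_{\theta\in\Theta,\,M\in\mathcal M}\sum_{j=1}^N\frac{\sigma_j\ell_{\theta,M}(c_j,x_j)}{\sqrt N}\Big],$$ and, with $p^T(x)$ the marginal of $p^T$ on $X$, $$I_2^T(X;R_\theta)=2\log_2\mathrm{Tr}\sqrt{\textstyle\sum_x p^T(x)\rho_\theta(x)^2}.$$ **Theorem.** Let $\delta\in(0,1)$. With probability at least $1-\delta$ over the draw of $\mathcal D$, the following holds for every $\hat\theta\in\arg\min_{\theta\in\Theta}\min_{M\in\mathcal M}\widehat R_{\theta,M}$ and every $\widehat M\in\arg\min_{M\in\mathcal M}\widehat R_{\hat\theta,M}$: $$R_{\hat\theta,\widehat M}-R_{\hat\theta}\;\le\;R_{\hat\theta,\widehat M}-\inf_{\theta\in\Theta}R_\theta\;\le\;\frac{2\big(\mathfrak R^T_{\Theta,\mathcal M}+\mathfrak R^T_{\mathcal M}\big)}{\sqrt N}+\sqrt{\frac2N\log\frac2\delta}.$$ In particular, this bounds the target excess risk, both relative to the best POVM for the trained $\hat\theta$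 and relative to the best pair $(\theta,M)$. Moreover $$\mathfrak R^T_{\mathcal M}\le\frac12\sqrt{\sup_{\theta\in\Theta}2^{I_2^T(X;R_\theta)}}.$$ -/

import Mathlib

open MeasureTheory
open scoped ComplexOrder MatrixOrder

noncomputable section

namespace QTL

/-- A density matrix: a positive semidefinite complex matrix of unit trace. -/
structure DensityMatrix (n : Type*) [Fintype n] where
  mat : Matrix n n ℂ
  posSemidef : mat.PosSemidef
  trace_eq_one : mat.trace = 1

/-- A binary POVM `M = {M₀, M₁}`. -/
structure BinaryPOVM (n : Type*) [Fintype n] [DecidableEq n] where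
  mat : Fin 2 → Matrix n n ℂ
  posSemidef : ∀ c, (mat c).PosSemidef
  sum_eq_one : ∑ c, mat c = 1

variable {X Θ n : Type*} [Fintype X] [MeasurableSpace X] [Fintype n] [DecidableEq n]

/-- The loss `ℓ_{θ,M}(c,x) = 1 - Tr(M_c ρ_θ(x))` (the trace is real). -/
def loss (ρ : Θ → X → DensityMatrix n) (θ : Θ) (M : BinaryPOVM n) (z : Fin 2 × X) : ℝ :=
  1 - ((M.mat z.1 * (ρ θ z.2).mat).trace).re

/-- The expected risk `R_{θ,M}`. -/
def expectedRisk (P : Measure (Fin 2 × X)) (ρ : Θ → X → DensityMatrix n)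
    (θ : Θ) (M : BinaryPOVM n) : ℝ :=
  ∫ z, loss ρ θ M z ∂P

/-- The minimum expected risk `R_θ = min_M R_{θ,M}` for a fixed embedding parameter. -/
def minExpectedRisk (P : Measure (Fin 2 × X)) (ρ : Θ → X → DensityMatrix n) (θ : Θ) : ℝ :=
  ⨅ M : BinaryPOVM n, expectedRisk P ρ θ M

/-- The training loss on the data set `D`. -/
def trainingLoss {N : ℕ} (ρ : Θ → X → DensityMatrix n) (D : Fin N → Fin 2 × X)
    (θ : Θ) (M : BinaryPOVM n) : ℝ :=
  (∑ j, loss ρ θ M (D j)) / N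

/-- The minimized training loss for a fixed embedding parameter. -/
def minTrainingLoss {N : ℕ} (ρ : Θ → X → DensityMatrix n) (D : Fin N → Fin 2 × X)
    (θ : Θ) : ℝ :=
  ⨅ M : BinaryPOVM n, trainingLoss ρ D θ M

/-- `θ` is an `arg min` of the minimized training loss over all embedding parameters, and `M` is
an `arg min` of the training loss for that `θ`. -/
def IsJointERM {N : ℕ} (ρ : Θ → X → DensityMatrix n) (D : Fin N → Fin 2 × X)
    (θ : Θ) (M : BinaryPOVM n) : Prop :=
  (∀ θ', minTrainingLoss ρ D θ ≤ minTrainingLoss ρ D θ') ∧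
    ∀ M', trainingLoss ρ D θ M ≤ trainingLoss ρ D θ M'

/-- The excess risk of `(θ, M)` relative to the best POVM for the same `θ`. -/
def excessRisk (P : Measure (Fin 2 × X)) (ρ : Θ → X → DensityMatrix n)
    (θ : Θ) (M : BinaryPOVM n) : ℝ :=
  expectedRisk P ρ θ M - minExpectedRisk P ρ θ

/-- The excess risk of `(θ, M)` relative to the best pair of embedding parameter and POVM. -/
def jointExcessRisk (P : Measure (Fin 2 × X)) (ρ : Θ → X → DensityMatrix n)
    (θ : Θ) (M : BinaryPOVM n) : ℝ :=
  expectedRisk P ρ θ M - ⨅ θ', minExpectedRisk P ρ θ'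

/-- The law of `N` i.i.d. samples from `P`. -/
def dataLaw (P : Measure (Fin 2 × X)) (N : ℕ) : Measure (Fin N → Fin 2 × X) :=
  Measure.pi fun _ => P

/-- Expectation over `N` i.i.d. uniform signs `σ_j ∈ {+1, -1}`. -/
def signAverage {N : ℕ} (f : (Fin N → ℤˣ) → ℝ) : ℝ :=
  (∑ σ, f σ) / 2 ^ N

/-- `∑_j σ_j ℓ_{θ,M}(c_j,x_j) / √N`. -/
def signedLoss {N : ℕ} (ρ : Θ → X → DensityMatrix n) (D : Fin N → Fin 2 × X)
    (σ : Fin N → ℤˣ) (θ : Θ) (M : BinaryPOVM n) : ℝ :=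
  ∑ j, ((σ j : ℤ) : ℝ) * loss ρ θ M (D j) / √N

/-- The Rademacher complexity of the space of binary POVMs. -/
def rademacherPOVM (P : Measure (Fin 2 × X)) (N : ℕ) (ρ : Θ → X → DensityMatrix n) : ℝ :=
  ⨆ θ : Θ, ∫ D, signAverage (fun σ => ⨆ M : BinaryPOVM n, signedLoss ρ D σ θ M) ∂(dataLaw P N)

/-- The joint Rademacher complexity of embedding parameters and binary POVMs. -/
def rademacherJoint (P : Measure (Fin 2 × X)) (N : ℕ) (ρ : Θ → X → DensityMatrix n) : ℝ :=
  ∫ D, signAverage (fun σ => ⨆ q : Θ × BinaryPOVM n, signedLoss ρ D σ q.1 q.2) ∂(dataLaw P N)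

/-- The marginal probability `p(x)`. -/
def marginal (P : Measure (Fin 2 × X)) (x : X) : ℝ :=
  (P.map Prod.snd).real {x}

/-- The 2-Rényi mutual information `I₂(X;R_θ) = 2 log₂ Tr √(∑ₓ p(x) ρ_θ(x)²)` (in bits), with the
positive semidefinite square root. -/
def renyiMI (P : Measure (Fin 2 × X)) (ρ : Θ → X → DensityMatrix n) (θ : Θ) : ℝ :=
  2 * Real.logb 2
    ((CFC.sqrt (∑ x, (marginal P x : ℂ) • (ρ θ x).mat ^ 2)).trace).re

end QTL

end

namespace QTL

/-! Risk bound: the two-stage minimizer minimizes the training loss over all pairs `q = (θ, M)`, so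
this is empirical risk minimization over `Θ × BinaryPOVM n`. Against a fixed near-optimal `q₀`, its
excess risk is at most the uniform deviation plus the fluctuation of the empirical mean at `q₀`. One
application of McDiarmid's inequality to the sum of both, with symmetrization for its mean, yields
`2 * rademacherJoint / √N` plus the confidence term (`excess_risk_of_empirical_minimizer`). The
summand `rademacherPOVM` in the bound is only a nonnegative surplus.

Rényi bound: up to a term independent of `M`, the signed loss is `Tr(S Q) / (2√N)`, with `S = M₀ -
M₁` satisfying `S² ≤ 1` and `Q` a signed sum of states. Completing a square with a weight `T > 0`
bounds it by `Tr T / 4 + Tr(Q T⁻¹ Q) / (4N)`. Here `Q` enters quadratically, so averaging over signs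
and data leaves `Tr(T⁻¹ A) / 4` in the second term, where `A = ∑ₓ p(x) ρ(x)²`. The choice `T = √A +
ε`, `ε → 0`, gives `Tr √A / 2`. -/

/-! ### Sign averages and boundedness of the suprema. -/

theorem signAverage_mono {N : ℕ} {f g : (Fin N → ℤˣ) → ℝ} (h : ∀ σ, f σ ≤ g σ) :
    signAverage f ≤ signAverage g :=
  div_le_div_of_nonneg_right (Finset.sum_le_sum fun σ _ => h σ) (by positivity)

theorem signAverage_const {N : ℕ} (a : ℝ) : signAverage (fun _ : Fin N → ℤˣ => a) = a := by
  simp [signAverage]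

theorem signAverage_add {N : ℕ} (f g : (Fin N → ℤˣ) → ℝ) :
    signAverage (fun σ => f σ + g σ) = signAverage f + signAverage g := by
  simp [signAverage, Finset.sum_add_distrib, add_div]

theorem signAverage_neg_arg {N : ℕ} (f : (Fin N → ℤˣ) → ℝ) :
    signAverage (fun σ => f (-σ)) = signAverage f := by
  exact congrArg (· / 2 ^ N) (Equiv.sum_comp (Equiv.neg (Fin N → ℤˣ)) f)

theorem signAverage_mul_const {N : ℕ} (f : (Fin N → ℤˣ) → ℝ) (a : ℝ) :
    signAverage (fun σ => f σ * a) = signAverage f * a := by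
  simp [signAverage, ← Finset.sum_mul, div_mul_eq_mul_div]

theorem signAverage_sum {ι : Type*} {N : ℕ} (s : Finset ι) (f : ι → (Fin N → ℤˣ) → ℝ) :
    signAverage (fun σ => ∑ i ∈ s, f i σ) = ∑ i ∈ s, signAverage (f i) := by
  simp only [signAverage]
  rw [Finset.sum_comm, Finset.sum_div]

theorem integral_signAverage {Ω : Type*} [Finite Ω] [MeasurableSpace Ω]
    [MeasurableSingletonClass Ω] (μ : Measure Ω) [IsFiniteMeasure μ] {N : ℕ}
    (F : Ω → (Fin N → ℤˣ) → ℝ) :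
    ∫ ω, signAverage (F ω) ∂μ = signAverage fun σ => ∫ ω, F ω σ ∂μ := by
  simp only [signAverage]
  rw [integral_div, integral_finsetSum _ fun σ _ => .of_finite]

theorem abs_units_cast (u : ℤˣ) : |((u : ℤ) : ℝ)| = 1 := by
  rcases Int.units_eq_one_or u with h | h <;> simp [h]

theorem abs_sum_signed_le {Z Q : Type*} {f : Q → Z → ℝ} (hf : ∀ q z, |f q z| ≤ 1) {N : ℕ} (σ : Fin N → ℤˣ) (D : Fin N → Z)
    (q : Q) : |∑ j, ((σ j : ℤ) : ℝ) * f q (D j)| ≤ N := by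
  refine (Finset.abs_sum_le_sum_abs _ _).trans ?_
  calc _ ≤ ∑ _j : Fin N, (1 : ℝ) := Finset.sum_le_sum fun j _ => by
        rw [abs_mul, abs_units_cast, one_mul]
        exact hf _ _
    _ = N := by simp

theorem bddAbove_sum_signed {Z Q : Type*} {f : Q → Z → ℝ} (hf : ∀ q z, |f q z| ≤ 1) {N : ℕ} (σ : Fin N → ℤˣ)
    (D : Fin N → Z) : BddAbove (Set.range fun q => ∑ j, ((σ j : ℤ) : ℝ) * f q (D j)) :=
  ⟨N, by rintro _ ⟨q, rfl⟩; exact (abs_le.1 (abs_sum_signed_le hf σ D q)).2⟩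

theorem abs_integral_le_one {Z : Type*} [MeasurableSpace Z] (P : Measure Z)
    [IsProbabilityMeasure P] {g : Z → ℝ} (hg : ∀ z, |g z| ≤ 1) : |∫ z, g z ∂P| ≤ 1 := by
  have := norm_integral_le_of_norm_le_const (μ := P) (f := g) (C := 1) (.of_forall hg)
  simpa using this

theorem bddAbove_sum_deviation {Z Q : Type*} [MeasurableSpace Z] (P : Measure Z)
    [IsProbabilityMeasure P] {f : Q → Z → ℝ} (hf : ∀ q z, |f q z| ≤ 1) {N : ℕ} (D : Fin N → Z) :
    BddAbove (Set.range fun q => ∑ j, (∫ z, f q z ∂P - f q (D j))) := by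
  refine ⟨∑ _j : Fin N, 2, ?_⟩
  rintro _ ⟨q, rfl⟩
  refine Finset.sum_le_sum fun j _ => ?_
  linarith [(abs_le.1 (hf q (D j))).1, (abs_le.1 (abs_integral_le_one P (hf q))).2]

/-! ### Concentration, symmetrization and empirical risk minimization on a finite space. -/

section FiniteSampleSpace

variable {Z Q : Type*} [Fintype Z] [MeasurableSpace Z] [MeasurableSingletonClass Z]
  (P : Measure Z) [IsProbabilityMeasure P]

theorem integral_pi_eq_sum {N : ℕ} (g : (Fin N → Z) → ℝ) :
    ∫ D, g D ∂(Measure.pi fun _ : Fin N => P) = ∑ D, (∏ j, P.real {D j}) * g D := by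
  rw [integral_fintype .of_finite]
  refine Finset.sum_congr rfl fun D _ => ?_
  simp [Measure.real, Measure.pi_singleton, ENNReal.toReal_prod]

theorem integral_pi_succ {N : ℕ} (g : (Fin (N + 1) → Z) → ℝ) :
    ∫ D, g D ∂(Measure.pi fun _ : Fin (N + 1) => P)
      = ∫ z, ∫ D, g (Fin.cons z D) ∂(Measure.pi fun _ : Fin N => P) ∂P := by
  simp only [integral_pi_eq_sum]
  rw [integral_fintype .of_finite, ← (Fin.consEquiv fun _ => Z).sum_comp, Fintype.sum_prod_type]
  refine Finset.sum_congr rfl fun z _ => ?_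
  rw [smul_eq_mul, Finset.mul_sum]
  refine Finset.sum_congr rfl fun D _ => ?_
  simp [Fin.consEquiv, Fin.prod_univ_succ, mul_assoc]

/-- **Hoeffding's lemma** on a finite space, in terms of the oscillation of the function. -/
theorem integral_exp_le_of_oscillation (g : Z → ℝ) {c : ℝ} (hg : ∀ z z', g z - g z' ≤ c) (t : ℝ) :
    ∫ z, Real.exp (t * (g z - ∫ z', g z' ∂P)) ∂P ≤ Real.exp ((c / 2) ^ 2 * t ^ 2 / 2) := by
  have hne : Nonempty Z := nonempty_of_isProbabilityMeasure P
  obtain ⟨z₀, hz₀⟩ := Finite.exists_min g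
  have hc : 0 ≤ c := by simpa using hg z₀ z₀
  have h := ProbabilityTheory.hasSubgaussianMGF_of_mem_Icc (μ := P) (X := g)
    (a := g z₀) (b := g z₀ + c) (measurable_of_finite g).aemeasurable
    (.of_forall fun z => ⟨hz₀ z, by linarith [hg z z₀]⟩)
  have h' := h.mgf_le t
  simpa [ProbabilityTheory.mgf, abs_of_nonneg hc] using h'

/-- Induction by conditioning on the first coordinate: the conditional mean `h` again oscillates by
at most `c`, so Hoeffding's lemma treats `h - E h` and the induction hypothesis treats `g - h`. -/
theorem integral_exp_le_of_bounded_differences {N : ℕ} (g : (Fin N → Z) → ℝ) {c : ℝ}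
    (hg : ∀ D i z, g (Function.update D i z) - g D ≤ c) (t : ℝ) :
    ∫ D, Real.exp (t * (g D - ∫ D', g D' ∂(Measure.pi fun _ => P))) ∂(Measure.pi fun _ => P)
      ≤ Real.exp (N * (c / 2) ^ 2 * t ^ 2 / 2) := by
  induction N with
  | zero => simp [integral_pi_eq_sum]
  | succ N ih =>
    set μ := Measure.pi fun _ : Fin N => P
    set h : Z → ℝ := fun z => ∫ D, g (Fin.cons z D) ∂μ with hh
    have hE : ∫ D', g D' ∂(Measure.pi fun _ => P) = ∫ z, h z ∂P := integral_pi_succ P g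
    have hosc : ∀ z z', h z - h z' ≤ c := by
      intro z z'
      rw [hh]
      simp only
      rw [← integral_sub .of_finite .of_finite]
      calc _ ≤ ∫ _, c ∂μ := by
            refine integral_mono .of_finite .of_finite fun D => ?_
            have := hg (Fin.cons z' D) 0 z
            rwa [Fin.update_cons_zero] at this
        _ = c := by simp
    have hin : ∀ z, ∫ D, Real.exp (t * (g (Fin.cons z D) - h z)) ∂μ
        ≤ Real.exp (N * (c / 2) ^ 2 * t ^ 2 / 2) := by
      intro z
      refine ih (fun D => g (Fin.cons z D)) fun D i z' => ?_
      rw [Fin.cons_update]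
      exact hg _ _ _
    rw [hE, integral_pi_succ]
    calc _ = ∫ z, Real.exp (t * (h z - ∫ z', h z' ∂P))
              * ∫ D, Real.exp (t * (g (Fin.cons z D) - h z)) ∂μ ∂P := by
          refine integral_congr_ae (.of_forall fun z => ?_)
          simp only
          rw [← integral_const_mul]
          refine integral_congr_ae (.of_forall fun D => ?_)
          simp only
          rw [← Real.exp_add]
          ring_nf
      _ ≤ ∫ z, Real.exp (t * (h z - ∫ z', h z' ∂P))
              * Real.exp (N * (c / 2) ^ 2 * t ^ 2 / 2) ∂P := by
          refine integral_mono .of_finite .of_finite fun z => ?_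
          exact mul_le_mul_of_nonneg_left (hin z) (Real.exp_pos _).le
      _ ≤ Real.exp ((c / 2) ^ 2 * t ^ 2 / 2) * Real.exp (N * (c / 2) ^ 2 * t ^ 2 / 2) := by
          rw [integral_mul_const]
          exact mul_le_mul_of_nonneg_right (integral_exp_le_of_oscillation P h hosc t)
            (Real.exp_pos _).le
      _ = _ := by
          rw [← Real.exp_add]
          push_cast
          ring_nf

/-- **McDiarmid's inequality** on a finite space. -/
theorem measure_ge_le_of_bounded_differences {N : ℕ} (g : (Fin N → Z) → ℝ) {c : ℝ}
    (hg : ∀ D i z, g (Function.update D i z) - g D ≤ c) {s : ℝ} (hs : 0 ≤ s) :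
    (Measure.pi fun _ => P).real {D | s ≤ g D - ∫ D', g D' ∂(Measure.pi fun _ => P)}
      ≤ Real.exp (-s ^ 2 / (2 * (N * (c / 2) ^ 2))) := by
  have h : ProbabilityTheory.HasSubgaussianMGF
      (fun D => g D - ∫ D', g D' ∂(Measure.pi fun _ => P))
      ⟨N * (c / 2) ^ 2, by positivity⟩ (Measure.pi fun _ => P) :=
    ⟨fun t => .of_finite, integral_exp_le_of_bounded_differences P g hg⟩
  exact h.measure_ge_le hs

/-- Exchanging the coordinates with a negative sign between two independent samples
does not change their joint law. -/
theorem integral_pi_swap_signs {N : ℕ} (Φ : (Fin N → Z) → (Fin N → Z) → ℝ) (σ : Fin N → ℤˣ) :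
    ∫ D, ∫ D', Φ (fun j => if σ j = 1 then D j else D' j) (fun j => if σ j = 1 then D' j else D j)
        ∂(Measure.pi fun _ => P) ∂(Measure.pi fun _ => P)
      = ∫ D, ∫ D', Φ D D' ∂(Measure.pi fun _ => P) ∂(Measure.pi fun _ => P) := by
  simp only [integral_pi_eq_sum, Finset.mul_sum]
  rw [← Fintype.sum_prod_type', ← Fintype.sum_prod_type']
  have hinv : Function.Involutive fun p : (Fin N → Z) × (Fin N → Z) =>
      ((fun j => if σ j = 1 then p.1 j else p.2 j), fun j => if σ j = 1 then p.2 j else p.1 j) := by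
    intro p
    ext j <;> by_cases h : σ j = 1 <;> simp [h]
  rw [← Equiv.sum_comp hinv.toPerm]
  refine Finset.sum_congr rfl fun p _ => ?_
  simp only [Function.Involutive.coe_toPerm]
  rw [← mul_assoc, ← mul_assoc, ← Finset.prod_mul_distrib, ← Finset.prod_mul_distrib]
  congr 2
  · funext j
    by_cases h : σ j = 1 <;> simp [h, mul_comm]
  · exact congrArg Prod.fst (hinv p)
  · exact congrArg Prod.snd (hinv p)

variable {f : Q → Z → ℝ}

/-- **Symmetrization**: the expected uniform deviation is at most twice the (unnormalized)
Rademacher complexity. -/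
theorem integral_iSup_deviation_le [Nonempty Q] (hf : ∀ q z, |f q z| ≤ 1) (N : ℕ) :
    ∫ D, ⨆ q, ∑ j, (∫ z, f q z ∂P - f q (D j)) ∂(Measure.pi fun _ : Fin N => P)
      ≤ 2 * ∫ D, signAverage (fun σ => ⨆ q, ∑ j, ((σ j : ℤ) : ℝ) * f q (D j))
          ∂(Measure.pi fun _ : Fin N => P) := by
  set μ := Measure.pi fun _ : Fin N => P
  set S : (Fin N → Z) → (Fin N → ℤˣ) → ℝ :=
    fun D σ => ⨆ q, ∑ j, ((σ j : ℤ) : ℝ) * f q (D j) with hS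
  set Φ : (Fin N → ℤˣ) → (Fin N → Z) → (Fin N → Z) → ℝ :=
    fun σ D D' => ⨆ q, ∑ j, ((σ j : ℤ) : ℝ) * (f q (D' j) - f q (D j)) with hΦ
  have hsum : ∀ σ D D' q, ∑ j, ((σ j : ℤ) : ℝ) * (f q (D' j) - f q (D j)) ≤ S D' σ + S D (-σ) := by
    intro σ D D' q
    have h1 := le_ciSup (bddAbove_sum_signed hf σ D') q
    have h2 := le_ciSup (bddAbove_sum_signed hf (-σ) D) q
    refine le_trans (le_of_eq ?_) (add_le_add h1 h2)
    simp [mul_add, Finset.sum_add_distrib, sub_eq_add_neg]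
  have hΦle : ∀ σ D D', Φ σ D D' ≤ S D' σ + S D (-σ) := fun σ D D' => ciSup_le (hsum σ D D')
  -- The mean is rewritten as an average over a ghost sample `D'`, and the supremum is moved inside
  -- that average.
  have hghost : ∀ D, ⨆ q, ∑ j, (∫ z, f q z ∂P - f q (D j)) ≤ ∫ D', Φ 1 D D' ∂μ := by
    intro D
    refine ciSup_le fun q => ?_
    have : ∑ j, (∫ z, f q z ∂P - f q (D j))
        = ∫ D', ∑ j, (((1 : Fin N → ℤˣ) j : ℤ) : ℝ) * (f q (D' j) - f q (D j)) ∂μ := by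
      rw [integral_finsetSum _ fun j _ => .of_finite]
      refine Finset.sum_congr rfl fun j _ => ?_
      simp only [Pi.one_apply, Units.val_one, Int.cast_one, one_mul]
      rw [integral_sub .of_finite .of_finite,
        integral_comp_eval (μ := fun _ : Fin N => P) (i := j) (f := f q)
          (measurable_of_finite _).aestronglyMeasurable]
      simp [μ]
    rw [this]
    refine integral_mono .of_finite .of_finite fun D' => ?_
    exact le_ciSup (f := fun q => ∑ j, (((1 : Fin N → ℤˣ) j : ℤ) : ℝ) * (f q (D' j) - f q (D j)))
      ⟨_, by rintro _ ⟨q, rfl⟩; exact hsum 1 D D' q⟩ q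
  -- Exchanging `D j` and `D' j` flips the sign of the `j`-th difference, so every sign pattern
  -- gives the same integral and averaging over `σ` is free.
  have hswap : ∀ σ, ∫ D, ∫ D', Φ σ D D' ∂μ ∂μ = ∫ D, ∫ D', Φ 1 D D' ∂μ ∂μ := by
    intro σ
    rw [← integral_pi_swap_signs P (Φ 1) σ]
    simp only [hΦ]
    congr! 7 with D D' q j
    rcases Int.units_eq_one_or (σ j) with h | h <;> simp [h]
  calc _ ≤ ∫ D, ∫ D', Φ 1 D D' ∂μ ∂μ := integral_mono .of_finite .of_finite hghost
    _ = signAverage fun σ : Fin N → ℤˣ => ∫ D, ∫ D', Φ σ D D' ∂μ ∂μ := by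
        simp only [hswap, signAverage_const]
    _ ≤ signAverage fun σ : Fin N → ℤˣ => (∫ D, S D σ ∂μ) + ∫ D, S D (-σ) ∂μ := by
        refine signAverage_mono fun σ => ?_
        calc _ ≤ ∫ D, ∫ D', (S D' σ + S D (-σ)) ∂μ ∂μ :=
              integral_mono .of_finite .of_finite fun D =>
                integral_mono .of_finite .of_finite fun D' => hΦle σ D D'
          _ = _ := by
              have : ∀ D, ∫ D', (S D' σ + S D (-σ)) ∂μ = (∫ D', S D' σ ∂μ) + S D (-σ) := by
                intro D
                rw [integral_add .of_finite .of_finite]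
                simp
              simp only [this]
              rw [integral_add .of_finite .of_finite]
              simp
    _ = _ := by
        rw [signAverage_add, signAverage_neg_arg fun σ => ∫ D, S D σ ∂μ, ← integral_signAverage,
          two_mul]

/-- The excess risk of empirical risk minimizers is controlled by the Rademacher complexity. -/
theorem excess_risk_of_empirical_minimizer [Nonempty Q] (hf : ∀ q z, f q z ∈ Set.Icc (0 : ℝ) 1)
    {N : ℕ} (hN : 0 < N) {δ : ℝ} (hδ0 : 0 < δ) (hδ1 : δ < 1) :
    1 - δ ≤ (Measure.pi fun _ : Fin N => P).real
      {D | ∀ q, (∀ q', ∑ j, f q (D j) ≤ ∑ j, f q' (D j)) →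
        ∫ z, f q z ∂P - ⨅ q', ∫ z, f q' z ∂P
          ≤ 2 * (∫ D, signAverage (fun σ => ⨆ q, ∑ j, ((σ j : ℤ) : ℝ) * f q (D j) / √N)
              ∂(Measure.pi fun _ : Fin N => P)) / √N + √(2 / N * Real.log (2 / δ))} := by
  have hf' : ∀ q z, |f q z| ≤ 1 := fun q z => by
    rw [abs_le]
    exact ⟨by linarith [(hf q z).1], (hf q z).2⟩
  have hN' : (0 : ℝ) < N := by exact_mod_cast hN
  set μ := Measure.pi fun _ : Fin N => P
  set R := ∫ D, signAverage (fun σ => ⨆ q, ∑ j, ((σ j : ℤ) : ℝ) * f q (D j)) ∂μ with hR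
  have hRad : ∫ D, signAverage (fun σ => ⨆ q, ∑ j, ((σ j : ℤ) : ℝ) * f q (D j) / √N) ∂μ
      = R / √N := by
    rw [hR, ← integral_div]
    congr! 2 with D
    simp only [signAverage, ← Finset.sum_div, div_right_comm _ ((2 : ℝ) ^ N)]
    congr 2
    rw [Finset.sum_div]
    refine Finset.sum_congr rfl fun σ _ => ?_
    simp only [div_eq_mul_inv]
    rw [Real.iSup_mul_of_nonneg (by positivity)]
  set t := √(2 / N * Real.log (2 / δ))
  -- The tail bound needs only `log (1 / δ)`. The gap `t - t' > 0` pays for a near-minimizer `q₀`,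
  -- since the infimum of the risk may not be attained.
  set t' := √(2 / N * Real.log (1 / δ))
  have hlog : 0 ≤ Real.log (1 / δ) := Real.log_nonneg (by rw [le_div_iff₀ hδ0]; linarith)
  have htt : t' < t := by
    refine Real.sqrt_lt_sqrt (by positivity) ?_
    refine mul_lt_mul_of_pos_left (Real.log_lt_log (by positivity) ?_) (by positivity)
    exact div_lt_div_of_pos_right (by norm_num) hδ0
  obtain ⟨q₀, hq₀⟩ := exists_lt_of_ciInf_lt
    (show ⨅ q', ∫ z, f q' z ∂P < (⨅ q', ∫ z, f q' z ∂P) + (t - t') by linarith)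
  -- `G` adds to `H` the centred sum at `q₀`. Each part changes by at most 1 when one sample
  -- changes, whence the difference constant 2; the added part has mean zero.
  set H : (Fin N → Z) → ℝ := fun D => ⨆ q, ∑ j, (∫ z, f q z ∂P - f q (D j)) with hH
  set G : (Fin N → Z) → ℝ :=
    fun D => H D + ∑ j, (f q₀ (D j) - ∫ z, f q₀ z ∂P) with hG
  have hupd : ∀ (g : Z → ℝ) (hg : ∀ z, g z ∈ Set.Icc (0 : ℝ) 1) (D : Fin N → Z) (i : Fin N) (z : Z),
      |∑ j, g (Function.update D i z j) - ∑ j, g (D j)| ≤ 1 := by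
    intro g hg D i z
    rw [← Finset.sum_sub_distrib, Finset.sum_eq_single i]
    · rw [Function.update_self, abs_le]
      exact ⟨by linarith [(hg z).1, (hg (D i)).2], by linarith [(hg z).2, (hg (D i)).1]⟩
    · intro j _ hj
      simp [Function.update_of_ne hj]
    · simp
  have hGdiff : ∀ D i z, G (Function.update D i z) - G D ≤ 2 := by
    intro D i z
    have h1 : H (Function.update D i z) ≤ H D + 1 := by
      refine ciSup_le fun q => ?_
      have hq := le_ciSup (bddAbove_sum_deviation P hf' D) q
      have := (abs_le.1 (hupd (f q) (hf q) D i z)).1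
      simp only [Finset.sum_sub_distrib] at hq this ⊢
      simp only [hH, Finset.sum_sub_distrib]
      linarith
    have h2 := (abs_le.1 (hupd (f q₀) (hf q₀) D i z)).2
    simp only [hG, Finset.sum_sub_distrib]
    linarith
  have hEG : ∫ D, G D ∂μ ≤ 2 * R := by
    rw [hG, integral_add .of_finite .of_finite, integral_finsetSum _ fun j _ => .of_finite]
    have : ∀ j : Fin N, ∫ D, (f q₀ (D j) - ∫ z, f q₀ z ∂P) ∂μ = 0 := by
      intro j
      rw [integral_sub .of_finite .of_finite,
        integral_comp_eval (μ := fun _ : Fin N => P) (i := j) (f := f q₀)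
          (measurable_of_finite _).aestronglyMeasurable]
      simp [μ]
    simp only [this, Finset.sum_const_zero, add_zero]
    exact integral_iSup_deviation_le P hf' N
  have htail : μ.real {D | N * t' ≤ G D - ∫ D', G D' ∂μ} ≤ δ := by
    refine (measure_ge_le_of_bounded_differences P G hGdiff
      (mul_nonneg hN'.le (Real.sqrt_nonneg _))).trans (le_of_eq ?_)
    rw [mul_pow, Real.sq_sqrt (by positivity), one_div, Real.log_inv]
    rw [show -((N : ℝ) ^ 2 * (2 / N * -Real.log δ)) / (2 * (N * (2 / 2) ^ 2)) = Real.log δ by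
      field_simp]
    exact Real.exp_log hδ0
  have hcompl := probReal_compl_eq_one_sub (μ := μ)
    (s := {D | N * t' ≤ G D - ∫ D', G D' ∂μ}) (Set.toFinite _).measurableSet
  calc 1 - δ ≤ μ.real {D | N * t' ≤ G D - ∫ D', G D' ∂μ}ᶜ := by rw [hcompl]; linarith
    _ ≤ _ := by
      refine measureReal_mono fun D hD q hq => ?_
      simp only [Set.mem_compl_iff, Set.mem_ofPred_eq, not_le] at hD
      have h1 := le_ciSup (bddAbove_sum_deviation P hf' D) q
      have h2 := hq q₀
      simp only [hG, hH] at hD hEG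
      simp only [Finset.sum_sub_distrib, Finset.sum_const, Finset.card_univ, Fintype.card_fin,
        nsmul_eq_mul] at h1 hD hEG
      have h3 : N * (∫ z, f q z ∂P - ∫ z, f q₀ z ∂P) ≤ 2 * R + N * t' := by
        rw [mul_sub]; linarith
      have h4 : ∫ z, f q z ∂P - ∫ z, f q₀ z ∂P ≤ 2 * R / N + t' := by
        rw [← sub_nonneg] at h3 ⊢
        have : 2 * R / N + t' - (∫ z, f q z ∂P - ∫ z, f q₀ z ∂P)
          = (2 * R + N * t' - N * (∫ z, f q z ∂P - ∫ z, f q₀ z ∂P)) / N := by field_simp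
        rw [this]
        exact div_nonneg h3 hN'.le
      rw [hRad]
      have h5 : 2 * (R / √N) / √N = 2 * R / N := by
        rw [← mul_div_assoc, div_div, Real.mul_self_sqrt hN'.le]
      rw [h5]
      linarith

end FiniteSampleSpace

/-! ### Trace inequalities for positive matrices. -/

section MatrixInequalities

open Matrix

theorem re_trace_nonneg {n : Type*} [Fintype n] {A : Matrix n n ℂ} (hA : A.PosSemidef) : 0 ≤ A.trace.re :=
  (Complex.le_def.1 hA.trace_nonneg).1

variable {n : Type*} [Fintype n] [DecidableEq n]

theorem re_trace_mul_nonneg {A B : Matrix n n ℂ} (hA : A.PosSemidef) (hB : B.PosSemidef) :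
    0 ≤ (A * B).trace.re := by
  have hs : (CFC.sqrt B).PosSemidef := nonneg_iff_posSemidef.1 (CFC.sqrt_nonneg B)
  have h := re_trace_nonneg (hA.conjTranspose_mul_mul_same (CFC.sqrt B))
  rwa [hs.1.eq, mul_assoc, trace_mul_comm, mul_assoc,
    CFC.sqrt_mul_sqrt_self B (nonneg_iff_posSemidef.2 hB)] at h

theorem re_trace_mul_self_le_one {A : Matrix n n ℂ} (hA : A.PosSemidef) (htr : A.trace = 1) :
    (A * A).trace.re ≤ 1 := by
  have hsum : ∑ i, hA.1.eigenvalues i = 1 := by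
    have h := hA.1.trace_eq_sum_eigenvalues
    rw [htr] at h
    simpa using (congrArg Complex.re h).symm
  have hsq : (A * A).trace.re = ∑ i, hA.1.eigenvalues i * hA.1.eigenvalues i := by
    conv_lhs => rw [hA.1.spectral_theorem, ← map_mul]
    rw [Unitary.conjStarAlgAut_apply, trace_mul_cycle, Unitary.coe_star_mul_self, one_mul,
      diagonal_mul_diagonal, trace_diagonal]
    simp
  rw [hsq, ← hsum]
  refine Finset.sum_le_sum fun i hi => ?_
  have h0 := hA.eigenvalues_nonneg i
  have h1 : hA.1.eigenvalues i ≤ 1 :=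
    hsum ▸ Finset.single_le_sum (fun j _ => hA.eigenvalues_nonneg j) hi
  nlinarith

/-- For a Hermitian contraction `S`, Hermitian `Q` and positive definite `T`, the trace pairing
of `S` and `Q` is controlled by `T` and the `T⁻¹`-weighted square of `Q`. -/
theorem two_mul_re_trace_mul_le {S Q T : Matrix n n ℂ} (hS : S.IsHermitian)
    (hS1 : (1 - S * S).PosSemidef) (hQ : Q.IsHermitian) (hT : T.PosDef) (c : ℝ) :
    2 * c * (S * Q).trace.re ≤ c ^ 2 * T.trace.re + (Q * T⁻¹ * Q).trace.re := by
  have hdet : IsUnit T.det := (isUnit_iff_isUnit_det T).1 hT.isUnit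
  -- Completing the square: this trace equals `c² Tr(T S²) - 2c Tr(S Q) + Tr(Q T⁻¹ Q)`, and `Tr(T
  -- S²) ≤ Tr T` because `S² ≤ 1`.
  have h1 := re_trace_nonneg (hT.inv.posSemidef.conjTranspose_mul_mul_same ((c : ℂ) • (T * S) - Q))
  have h2 := re_trace_mul_nonneg hT.posSemidef hS1
  have hexp : ((c : ℂ) • (T * S) - Q)ᴴ * T⁻¹ * ((c : ℂ) • (T * S) - Q)
      = ((c ^ 2 : ℝ) : ℂ) • (S * (T * S)) - (c : ℂ) • (S * Q) - (c : ℂ) • (Q * S)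
        + Q * T⁻¹ * Q := by
    have e1 : S * T * T⁻¹ = S := by rw [mul_assoc, mul_nonsing_inv _ hdet, mul_one]
    have e2 : Q * T⁻¹ * (T * S) = Q * S := by
      rw [mul_assoc, ← mul_assoc T⁻¹, nonsing_inv_mul _ hdet, one_mul]
    rw [conjTranspose_sub, conjTranspose_smul, conjTranspose_mul, hS.eq, hQ.eq, hT.isHermitian.eq]
    simp only [sub_mul, mul_sub, smul_mul_assoc, mul_smul_comm, e1, e2, smul_sub, smul_smul]
    simp only [RCLike.star_def, Complex.conj_ofReal]
    push_cast
    rw [pow_two]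
    abel
  have h3 : (S * (T * S)).trace = (T * (S * S)).trace := by
    rw [trace_mul_comm, mul_assoc]
  rw [hexp] at h1
  simp only [trace_add, trace_sub, trace_smul, smul_eq_mul, h3, trace_mul_comm Q S, Complex.add_re,
    Complex.sub_re, Complex.re_ofReal_mul] at h1
  rw [mul_sub, mul_one, trace_sub, Complex.sub_re] at h2
  nlinarith [mul_nonneg (sq_nonneg c) h2]

/-- The shift by `ε` makes `T = √A + ε` invertible. From `T √A = A + ε √A` one gets `T⁻¹ A = √A - ε
T⁻¹ √A`, whose last term has nonnegative trace before the minus sign. -/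
theorem re_trace_inv_mul_le {A : Matrix n n ℂ} (hA : A.PosSemidef) {ε : ℝ} (hε : 0 < ε) :
    (CFC.sqrt A + (ε : ℂ) • 1).PosDef ∧
      ((CFC.sqrt A + (ε : ℂ) • 1)⁻¹ * A).trace.re ≤ (CFC.sqrt A).trace.re := by
  have hs : (CFC.sqrt A).PosSemidef := nonneg_iff_posSemidef.1 (CFC.sqrt_nonneg A)
  have hT : (CFC.sqrt A + (ε : ℂ) • 1).PosDef :=
    PosDef.posSemidef_add hs (PosDef.one.smul (by exact_mod_cast hε))
  refine ⟨hT, ?_⟩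
  set T := CFC.sqrt A + (ε : ℂ) • 1
  have hdet : IsUnit T.det := (isUnit_iff_isUnit_det T).1 hT.isUnit
  have h := re_trace_mul_nonneg hT.inv.posSemidef hs
  have e : T⁻¹ * A = CFC.sqrt A - (ε : ℂ) • (T⁻¹ * CFC.sqrt A) := by
    have e1 : T⁻¹ * (T * CFC.sqrt A) = CFC.sqrt A := by
      rw [← mul_assoc, nonsing_inv_mul _ hdet, one_mul]
    have e2 : T * CFC.sqrt A = A + (ε : ℂ) • CFC.sqrt A := by
      rw [add_mul, CFC.sqrt_mul_sqrt_self A (nonneg_iff_posSemidef.2 hA), smul_mul_assoc, one_mul]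
    rw [e2, mul_add, mul_smul_comm] at e1
    exact eq_sub_of_add_eq e1
  rw [e, trace_sub, trace_smul, Complex.sub_re, smul_eq_mul, Complex.re_ofReal_mul]
  nlinarith

theorem re_trace_sqrt_le {A : Matrix n n ℂ} (hA : A.PosSemidef) :
    2 * (CFC.sqrt A).trace.re ≤ A.trace.re + Fintype.card n := by
  have hs : (CFC.sqrt A).PosSemidef := nonneg_iff_posSemidef.1 (CFC.sqrt_nonneg A)
  have h := re_trace_nonneg (posSemidef_conjTranspose_mul_self (CFC.sqrt A - 1))
  rw [conjTranspose_sub, hs.1.eq, conjTranspose_one, sub_mul, mul_sub, mul_sub,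
    CFC.sqrt_mul_sqrt_self A (nonneg_iff_posSemidef.2 hA)] at h
  simp only [one_mul, mul_one, trace_sub, trace_one, Complex.sub_re, Complex.natCast_re] at h
  linarith

end MatrixInequalities

/-! ### Binary POVMs and the loss in terms of their observables. -/

section Povm

variable {n : Type*} [Fintype n] [DecidableEq n]

/-- The observable `M₀ - M₁` of a binary POVM. -/
def BinaryPOVM.observable (M : BinaryPOVM n) : Matrix n n ℂ := M.mat 0 - M.mat 1

theorem BinaryPOVM.mat_add (M : BinaryPOVM n) : M.mat 0 + M.mat 1 = 1 := by
  simpa using M.sum_eq_one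

theorem BinaryPOVM.isHermitian_observable (M : BinaryPOVM n) : M.observable.IsHermitian :=
  (M.posSemidef 0).1.sub (M.posSemidef 1).1

/-- Since `M₁ = 1 - M₀` commutes with `M₀`, `1 - (M₀ - M₁)² = 4 M₀ M₁ = 4 (M₀ M₁ M₀ + M₁ M₀ M₁)`. -/
theorem BinaryPOVM.one_sub_observable_sq (M : BinaryPOVM n) :
    (1 - M.observable * M.observable).PosSemidef := by
  have h1 : M.mat 1 = 1 - M.mat 0 := eq_sub_of_add_eq' M.mat_add
  have h010 := (M.posSemidef 1).conjTranspose_mul_mul_same (M.mat 0)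
  have h101 := (M.posSemidef 0).conjTranspose_mul_mul_same (M.mat 1)
  rw [(M.posSemidef 0).1.eq] at h010
  rw [(M.posSemidef 1).1.eq] at h101
  have h := (h010.add h101).smul (a := (4 : ℂ)) (by norm_num)
  convert h using 1
  rw [observable, h1]
  rw [show (4 : ℂ) • (M.mat 0 * (1 - M.mat 0) * M.mat 0
      + (1 - M.mat 0) * M.mat 0 * (1 - M.mat 0))
      = (4 : ℕ) • (M.mat 0 * (1 - M.mat 0) * M.mat 0
      + (1 - M.mat 0) * M.mat 0 * (1 - M.mat 0)) by rw [← Nat.cast_smul_eq_nsmul ℂ]; norm_num]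
  noncomm_ring

instance : Nonempty (BinaryPOVM n) :=
  ⟨⟨![1, 0], fun c => by
    fin_cases c
    · exact Matrix.PosSemidef.one
    · exact Matrix.PosSemidef.zero, by simp⟩⟩

variable {X Θ : Type*} (ρ : Θ → X → DensityMatrix n)

theorem loss_mem_Icc (θ : Θ) (M : BinaryPOVM n) (z : Fin 2 × X) :
    loss ρ θ M z ∈ Set.Icc (0 : ℝ) 1 := by
  have h : ∀ c, 0 ≤ (M.mat c * (ρ θ z.2).mat).trace.re := fun c =>
    re_trace_mul_nonneg (M.posSemidef c) (ρ θ z.2).posSemidef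
  have hsum : (M.mat 0 * (ρ θ z.2).mat).trace.re + (M.mat 1 * (ρ θ z.2).mat).trace.re = 1 := by
    rw [← Complex.add_re, ← Matrix.trace_add, ← add_mul, M.mat_add, one_mul,
      (ρ θ z.2).trace_eq_one, Complex.one_re]
  obtain ⟨c, x⟩ := z
  refine ⟨?_, by simp only [loss]; linarith [h c]⟩
  have h0 := h 0
  have h1 := h 1
  fin_cases c <;> simp only [loss, Fin.zero_eta, Fin.mk_one] <;> linarith

/-- The sign `+1` for class `0` and `-1` for class `1`. -/
def classSign (c : Fin 2) : ℝ := if c = 0 then 1 else -1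

theorem classSign_mul_self (c : Fin 2) : classSign c * classSign c = 1 := by
  fin_cases c <;> simp [classSign]

theorem loss_eq (θ : Θ) (M : BinaryPOVM n) (z : Fin 2 × X) :
    loss ρ θ M z = 1 / 2 - classSign z.1 * (M.observable * (ρ θ z.2).mat).trace.re / 2 := by
  have hsum : (M.mat 0 * (ρ θ z.2).mat).trace.re + (M.mat 1 * (ρ θ z.2).mat).trace.re = 1 := by
    rw [← Complex.add_re, ← Matrix.trace_add, ← add_mul, M.mat_add, one_mul,
      (ρ θ z.2).trace_eq_one, Complex.one_re]
  obtain ⟨c, x⟩ := z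
  simp only [BinaryPOVM.observable, sub_mul, Matrix.trace_sub, Complex.sub_re, loss]
  fin_cases c <;> simp [classSign] <;> simp at hsum <;> linarith

end Povm

/-! ### First and second moments of random signs. -/

section SignMoments

variable {N : ℕ}

theorem signAverage_mul_left (τ : Fin N → ℤˣ) (f : (Fin N → ℤˣ) → ℝ) :
    signAverage (fun σ => f (τ * σ)) = signAverage f :=
  congrArg (· / 2 ^ N) (Equiv.sum_comp (Equiv.mulLeft τ) f)

/-- Flipping the `j`-th sign preserves the average but negates the integrand. -/
theorem signAverage_sign (j : Fin N) : signAverage (fun σ => ((σ j : ℤ) : ℝ)) = 0 := by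
  have h := signAverage_mul_left (Pi.mulSingle j (-1)) fun σ : Fin N → ℤˣ => ((σ j : ℤ) : ℝ)
  have h' := signAverage_mul_const (fun σ : Fin N → ℤˣ => ((σ j : ℤ) : ℝ)) (-1)
  simp only [Pi.mul_apply, Pi.mulSingle_eq_same, neg_one_mul, Units.val_neg, Int.cast_neg] at h
  simp only [mul_neg_one] at h'
  linarith

theorem signAverage_sign_mul_sign (j k : Fin N) :
    signAverage (fun σ => ((σ j : ℤ) : ℝ) * ((σ k : ℤ) : ℝ)) = if j = k then 1 else 0 := by
  split_ifs with hjk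
  · subst hjk
    have : ∀ u : ℤˣ, ((u : ℤ) : ℝ) * ((u : ℤ) : ℝ) = 1 := fun u => by
      rcases Int.units_eq_one_or u with h | h <;> simp [h]
    simp only [this, signAverage_const]
  · have h := signAverage_mul_left (Pi.mulSingle j (-1))
      fun σ : Fin N → ℤˣ => ((σ j : ℤ) : ℝ) * ((σ k : ℤ) : ℝ)
    have h' := signAverage_mul_const
      (fun σ : Fin N → ℤˣ => ((σ j : ℤ) : ℝ) * ((σ k : ℤ) : ℝ)) (-1)
    simp only [Pi.mul_apply, Pi.mulSingle_eq_same, Pi.mulSingle_eq_of_ne (Ne.symm hjk),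
      one_mul, Units.val_neg, Int.cast_neg, neg_mul] at h
    simp only [mul_neg_one] at h'
    linarith

end SignMoments

/-! ### Bounding the POVM Rademacher complexity by the Rényi information. -/

section RademacherPovm

variable {X Θ n : Type*} [Fintype n] (ρ : Θ → X → DensityMatrix n)

/-- The sign-weighted sum of the sampled density matrices. -/
def signedState {N : ℕ} (D : Fin N → Fin 2 × X) (θ : Θ) (σ : Fin N → ℤˣ) : Matrix n n ℂ :=
  ∑ j, ((((σ j : ℤ) : ℝ) * -classSign (D j).1 : ℝ) : ℂ) • (ρ θ (D j).2).mat

theorem isHermitian_signedState {N : ℕ} (D : Fin N → Fin 2 × X) (θ : Θ) (σ : Fin N → ℤˣ) :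
    (signedState ρ D θ σ).IsHermitian := by
  rw [Matrix.IsHermitian, signedState, Matrix.conjTranspose_sum]
  refine Finset.sum_congr rfl fun j _ => ?_
  rw [Matrix.conjTranspose_smul, (ρ θ (D j).2).posSemidef.1.eq, RCLike.star_def,
    Complex.conj_ofReal]

/-- The second moment of the signed state decouples over the sample. -/
theorem signAverage_re_trace_signedState {N : ℕ} (D : Fin N → Fin 2 × X) (θ : Θ)
    (B : Matrix n n ℂ) :
    signAverage (fun σ => (signedState ρ D θ σ * B * signedState ρ D θ σ).trace.re)
      = ∑ j, ((ρ θ (D j).2).mat * B * (ρ θ (D j).2).mat).trace.re := by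
  have h : ∀ σ, (signedState ρ D θ σ * B * signedState ρ D θ σ).trace.re
      = ∑ k, ∑ j, ((σ j : ℤ) : ℝ) * ((σ k : ℤ) : ℝ)
          * (classSign (D j).1 * classSign (D k).1
            * ((ρ θ (D j).2).mat * B * (ρ θ (D k).2).mat).trace.re) := by
    intro σ
    simp only [signedState, Finset.mul_sum, Finset.sum_mul, Matrix.trace_sum, Complex.re_sum,
      Matrix.mul_smul, Matrix.smul_mul, Matrix.trace_smul, smul_eq_mul, Complex.re_ofReal_mul]
    refine Finset.sum_congr rfl fun k _ => Finset.sum_congr rfl fun j _ => ?_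
    ring
  simp only [h, signAverage_sum, signAverage_mul_const, signAverage_sign_mul_sign]
  simp [classSign_mul_self]

variable [DecidableEq n]

theorem signedLoss_eq {N : ℕ} (D : Fin N → Fin 2 × X) (σ : Fin N → ℤˣ) (θ : Θ)
    (M : BinaryPOVM n) :
    signedLoss ρ D σ θ M = (∑ j, ((σ j : ℤ) : ℝ)) / (2 * √N)
      + (M.observable * signedState ρ D θ σ).trace.re / (2 * √N) := by
  have h : (M.observable * signedState ρ D θ σ).trace.re
      = ∑ j, ((σ j : ℤ) : ℝ) * -classSign (D j).1
          * (M.observable * (ρ θ (D j).2).mat).trace.re := by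
    simp only [signedState, Finset.mul_sum, Matrix.trace_sum, Complex.re_sum, Matrix.mul_smul,
      Matrix.trace_smul, smul_eq_mul, Complex.re_ofReal_mul]
  rw [h, ← add_div, ← Finset.sum_add_distrib, signedLoss, Finset.sum_div]
  refine Finset.sum_congr rfl fun j _ => ?_
  rw [loss_eq]
  ring

theorem signAverage_iSup_signedLoss_le {N : ℕ} (hN : 0 < N) (D : Fin N → Fin 2 × X) (θ : Θ)
    {T : Matrix n n ℂ} (hT : T.PosDef) :
    signAverage (fun σ => ⨆ M : BinaryPOVM n, signedLoss ρ D σ θ M)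
      ≤ T.trace.re / 4
        + (∑ j, ((ρ θ (D j).2).mat * T⁻¹ * (ρ θ (D j).2).mat).trace.re) / (4 * N) := by
  have hN' : (0 : ℝ) < N := by exact_mod_cast hN
  have hsq : √(N : ℝ) ^ 2 = N := Real.sq_sqrt hN'.le
  have hpos : 0 < √(N : ℝ) := Real.sqrt_pos.2 hN'
  have hle : ∀ σ, ⨆ M : BinaryPOVM n, signedLoss ρ D σ θ M
      ≤ (∑ j, ((σ j : ℤ) : ℝ)) * (2 * √N)⁻¹ + (T.trace.re / 4
        + (signedState ρ D θ σ * T⁻¹ * signedState ρ D θ σ).trace.re * (4 * N : ℝ)⁻¹) := by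
    intro σ
    refine ciSup_le fun M => ?_
    rw [signedLoss_eq, div_eq_mul_inv (∑ j, ((σ j : ℤ) : ℝ))]
    refine add_le_add le_rfl ?_
    -- The scale `c = √N` balances the two terms, `Q T⁻¹ Q` being of order `N` on average; dividing
    -- by `4N` gives the claim.
    have h := two_mul_re_trace_mul_le M.isHermitian_observable M.one_sub_observable_sq
      (isHermitian_signedState ρ D θ σ) hT (√N)
    rw [hsq] at h
    have e : (M.observable * signedState ρ D θ σ).trace.re / (2 * √N)
        = 2 * √N * (M.observable * signedState ρ D θ σ).trace.re * (4 * N : ℝ)⁻¹ := by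
      rw [← div_eq_mul_inv, div_eq_div_iff (by positivity) (by positivity)]
      linear_combination (-4 * (M.observable * signedState ρ D θ σ).trace.re) * hsq
    rw [e]
    refine (mul_le_mul_of_nonneg_right h (by positivity)).trans (le_of_eq ?_)
    field_simp
  refine (signAverage_mono hle).trans (le_of_eq ?_)
  rw [signAverage_add, signAverage_add, signAverage_mul_const, signAverage_mul_const,
    signAverage_const, signAverage_re_trace_signedState, signAverage_sum]
  simp [signAverage_sign, div_eq_mul_inv]

variable [MeasurableSpace X] (P : Measure (Fin 2 × X))

/-- The supremum dominates its value at one fixed POVM, whose signed loss averages to zero. -/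
theorem rademacherPOVM_nonneg (N : ℕ) : 0 ≤ rademacherPOVM P N ρ := by
  refine Real.iSup_nonneg fun θ => integral_nonneg fun D => ?_
  obtain ⟨M⟩ : Nonempty (BinaryPOVM n) := inferInstance
  have hbdd : ∀ σ, BddAbove (Set.range fun M : BinaryPOVM n => signedLoss ρ D σ θ M) := by
    intro σ
    refine ⟨∑ _j : Fin N, 1 / √N, ?_⟩
    rintro _ ⟨M, rfl⟩
    refine Finset.sum_le_sum fun j _ => div_le_div_of_nonneg_right ?_ (Real.sqrt_nonneg _)
    have hl := loss_mem_Icc ρ θ M (D j)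
    rcases Int.units_eq_one_or (σ j) with h | h <;> simp [h] <;> linarith [hl.1, hl.2]
  calc (0 : ℝ) = signAverage fun σ : Fin N → ℤˣ => signedLoss ρ D σ θ M := by
        simp only [signedLoss, mul_div_assoc, signAverage_sum, signAverage_mul_const,
          signAverage_sign, zero_mul, Finset.sum_const_zero]
    _ ≤ _ := signAverage_mono fun σ => le_ciSup (hbdd σ) M

theorem marginal_nonneg (x : X) : 0 ≤ marginal P x := measureReal_nonneg

variable [Fintype X]

/-- The averaged second moment `∑ₓ p(x) ρ_θ(x)²`. -/
noncomputable def secondMoment (θ : Θ) : Matrix n n ℂ := ∑ x, (marginal P x : ℂ) • (ρ θ x).mat ^ 2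

theorem posSemidef_secondMoment (θ : Θ) : (secondMoment ρ P θ).PosSemidef :=
  Matrix.posSemidef_sum _ fun x _ =>
    ((ρ θ x).posSemidef.pow 2).smul (by exact_mod_cast marginal_nonneg P x)

theorem sq_re_trace_sqrt_le (θ : Θ) :
    (CFC.sqrt (secondMoment ρ P θ)).trace.re ^ 2 ≤ (2 : ℝ) ^ renyiMI P ρ θ := by
  have h0 : 0 ≤ (CFC.sqrt (secondMoment ρ P θ)).trace.re :=
    re_trace_nonneg (Matrix.nonneg_iff_posSemidef.1 (CFC.sqrt_nonneg _))
  change _ ≤ (2 : ℝ) ^ (2 * Real.logb 2 (CFC.sqrt (secondMoment ρ P θ)).trace.re)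
  rcases h0.eq_or_lt with h | h
  -- With `Real.logb 2 0 = 0` the right side is 1 here, so the inequality survives, though not the
  -- equality.
  · simp [← h]
  · rw [mul_comm, Real.rpow_mul (by norm_num), Real.rpow_logb (by norm_num) (by norm_num) h,
      Real.rpow_two]

variable [MeasurableSingletonClass X] [IsProbabilityMeasure P]

theorem integral_comp_snd (g : X → ℝ) : ∫ z, g z.2 ∂P = ∑ x, marginal P x * g x := by
  rw [← integral_map (φ := Prod.snd) measurable_snd.aemeasurable
    (measurable_of_finite g).aestronglyMeasurable]
  have : IsFiniteMeasure (P.map Prod.snd) := inferInstance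
  rw [integral_fintype .of_finite]
  simp [marginal]

theorem sum_marginal : ∑ x, marginal P x = 1 := by
  simpa using (integral_comp_snd P fun _ => 1).symm

theorem re_trace_secondMoment_le_one (θ : Θ) : (secondMoment ρ P θ).trace.re ≤ 1 := by
  rw [secondMoment, Matrix.trace_sum, Complex.re_sum, ← sum_marginal P]
  refine Finset.sum_le_sum fun x _ => ?_
  rw [Matrix.trace_smul, smul_eq_mul, Complex.re_ofReal_mul, pow_two]
  exact mul_le_of_le_one_right (marginal_nonneg P x)
    (re_trace_mul_self_le_one (ρ θ x).posSemidef (ρ θ x).trace_eq_one)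

theorem integral_rademacherPOVM_le {N : ℕ} (hN : 0 < N) (θ : Θ) :
    ∫ D, signAverage (fun σ => ⨆ M : BinaryPOVM n, signedLoss ρ D σ θ M) ∂(dataLaw P N)
      ≤ (CFC.sqrt (secondMoment ρ P θ)).trace.re / 2 := by
  have hN' : (0 : ℝ) < N := by exact_mod_cast hN
  set A := secondMoment ρ P θ with hA
  refine le_of_forall_pos_le_add fun η hη => ?_
  set d : ℝ := (Fintype.card n : ℝ)
  have hd : 0 ≤ d := Nat.cast_nonneg _
  -- The shift adds `ε d` to `Tr T`; dividing by `d + 1` keeps this below `η` and also covers `d =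
  -- 0`.
  set ε := η / (d + 1) with hε'
  have hε : 0 < ε := by positivity
  have hεd : ε * d ≤ η := by
    rw [hε', div_mul_eq_mul_div, div_le_iff₀ (by positivity)]
    nlinarith
  obtain ⟨hT, hle⟩ := re_trace_inv_mul_le (posSemidef_secondMoment ρ P θ) hε
  set T := CFC.sqrt A + (ε : ℂ) • 1 with hTdef
  have htrT : T.trace.re = (CFC.sqrt A).trace.re + ε * d := by
    simp [hTdef, d]
  set g : X → ℝ := fun x => ((ρ θ x).mat * T⁻¹ * (ρ θ x).mat).trace.re
  have hg : ∑ x, marginal P x * g x = (T⁻¹ * A).trace.re := by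
    rw [hA, secondMoment, Finset.mul_sum, Matrix.trace_sum, Complex.re_sum]
    refine Finset.sum_congr rfl fun x _ => ?_
    rw [Matrix.mul_smul, Matrix.trace_smul, smul_eq_mul, Complex.re_ofReal_mul, pow_two,
      Matrix.trace_mul_comm T⁻¹, Matrix.mul_assoc, ← Matrix.trace_mul_comm (_ * T⁻¹)]
  calc _ ≤ ∫ D, (T.trace.re / 4 + (∑ j, g (D j).2) / (4 * N)) ∂(dataLaw P N) := by
        rw [dataLaw]
        exact integral_mono .of_finite .of_finite fun D =>
          signAverage_iSup_signedLoss_le ρ hN D θ hT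
    _ = T.trace.re / 4 + (T⁻¹ * A).trace.re / 4 := by
        rw [dataLaw, integral_add .of_finite .of_finite, integral_const, probReal_univ, one_smul,
          integral_div, integral_finsetSum _ fun j _ => .of_finite]
        have : ∀ j : Fin N, ∫ D, g (D j).2 ∂(Measure.pi fun _ : Fin N => P)
            = (T⁻¹ * A).trace.re := by
          intro j
          rw [integral_comp_eval (μ := fun _ : Fin N => P) (i := j) (f := fun z => g z.2)
            (measurable_of_finite _).aestronglyMeasurable, integral_comp_snd, hg]
        simp only [this]
        simp
        field_simp
    _ ≤ _ := by linarith

/-- `Θ` is arbitrary, and a real supremum of an unbounded family would be 0. The bound is uniform in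
`θ`: `2 Tr √A ≤ Tr A + d` with `Tr A ≤ 1`. -/
theorem bddAbove_two_rpow_renyiMI :
    BddAbove (Set.range fun θ => (2 : ℝ) ^ renyiMI P ρ θ) := by
  refine ⟨max 1 (((1 + Fintype.card n : ℝ) / 2) ^ 2), ?_⟩
  rintro _ ⟨θ, rfl⟩
  have h0 : 0 ≤ (CFC.sqrt (secondMoment ρ P θ)).trace.re :=
    re_trace_nonneg (Matrix.nonneg_iff_posSemidef.1 (CFC.sqrt_nonneg _))
  change (2 : ℝ) ^ (2 * Real.logb 2 (CFC.sqrt (secondMoment ρ P θ)).trace.re) ≤ _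
  rcases h0.eq_or_lt with h | h
  · simp [← h]
  · rw [mul_comm, Real.rpow_mul (by norm_num), Real.rpow_logb (by norm_num) (by norm_num) h,
      Real.rpow_two]
    refine le_max_of_le_right (pow_le_pow_left₀ h0 ?_ 2)
    linarith [re_trace_sqrt_le (posSemidef_secondMoment ρ P θ),
      re_trace_secondMoment_le_one ρ P θ]

theorem rademacherPOVM_le [Nonempty Θ] {N : ℕ} (hN : 0 < N) :
    rademacherPOVM P N ρ ≤ 0.5 * √(⨆ θ : Θ, (2 : ℝ) ^ renyiMI P ρ θ) := by
  refine ciSup_le fun θ => (integral_rademacherPOVM_le ρ P hN θ).trans ?_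
  have h := Real.le_sqrt_of_sq_le ((sq_re_trace_sqrt_le ρ P θ).trans
    (le_ciSup (bddAbove_two_rpow_renyiMI ρ P) θ))
  norm_num
  linarith

end RademacherPovm

/-! ### Two-stage minimizers and the two notions of excess risk. -/

section ExcessRisk

variable {X Θ n : Type*} [Fintype n] [DecidableEq n] (ρ : Θ → X → DensityMatrix n)

theorem IsJointERM.trainingLoss_le {N : ℕ} {D : Fin N → Fin 2 × X} {θ : Θ} {M : BinaryPOVM n}
    (h : IsJointERM ρ D θ M) (θ' : Θ) (M' : BinaryPOVM n) :
    trainingLoss ρ D θ M ≤ trainingLoss ρ D θ' M' := by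
  refine (le_ciInf h.2).trans ((h.1 θ').trans (ciInf_le ⟨0, ?_⟩ M'))
  rintro _ ⟨M, rfl⟩
  exact div_nonneg (Finset.sum_nonneg fun j _ => (loss_mem_Icc ρ θ' M (D j)).1) (Nat.cast_nonneg _)

variable [MeasurableSpace X] (P : Measure (Fin 2 × X))

theorem expectedRisk_nonneg (θ : Θ) (M : BinaryPOVM n) : 0 ≤ expectedRisk P ρ θ M :=
  integral_nonneg fun z => (loss_mem_Icc ρ θ M z).1

theorem excessRisk_le_jointExcessRisk (θ : Θ) (M : BinaryPOVM n) :
    excessRisk P ρ θ M ≤ jointExcessRisk P ρ θ M := by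
  refine sub_le_sub_left (ciInf_le ⟨0, ?_⟩ θ) _
  rintro _ ⟨θ', rfl⟩
  exact le_ciInf fun M => expectedRisk_nonneg ρ P θ' M

theorem iInf_expectedRisk [Nonempty Θ] :
    ⨅ q : Θ × BinaryPOVM n, expectedRisk P ρ q.1 q.2 = ⨅ θ, minExpectedRisk P ρ θ :=
  ciInf_prod ⟨0, by rintro _ ⟨q, rfl⟩; exact expectedRisk_nonneg ρ P q.1 q.2⟩

end ExcessRisk

end QTL

theorem mainTheorem2 {X Θ n : Type*} [Fintype X] [MeasurableSpace X] [MeasurableSingletonClass X]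
    [Nonempty Θ] [Fintype n] [DecidableEq n]
    (P : MeasureTheory.Measure (Fin 2 × X)) [MeasureTheory.IsProbabilityMeasure P]
    (ρ : Θ → X → QTL.DensityMatrix n) (N : ℕ) (hN : 0 < N) (δ : ℝ) (hδ0 : 0 < δ) (hδ1 : δ < 1) :
    1 - δ ≤ (QTL.dataLaw P N).real
        {D | ∀ (θhat : Θ) (Mhat : QTL.BinaryPOVM n), QTL.IsJointERM ρ D θhat Mhat →
          QTL.excessRisk P ρ θhat Mhat
              ≤ 2 * (QTL.rademacherJoint P N ρ + QTL.rademacherPOVM P N ρ) / √N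
                + √(2 / N * Real.log (2 / δ)) ∧
          QTL.jointExcessRisk P ρ θhat Mhat
              ≤ 2 * (QTL.rademacherJoint P N ρ + QTL.rademacherPOVM P N ρ) / √N
                + √(2 / N * Real.log (2 / δ))} ∧
      QTL.rademacherPOVM P N ρ ≤ 0.5 * √(⨆ θ : Θ, (2 : ℝ) ^ QTL.renyiMI P ρ θ) := by
  refine ⟨?_, QTL.rademacherPOVM_le ρ P hN⟩
  have hN' : (0 : ℝ) < N := by exact_mod_cast hN
  refine (QTL.excess_risk_of_empirical_minimizer P
    (f := fun q : Θ × QTL.BinaryPOVM n => QTL.loss ρ q.1 q.2)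
    (fun q z => QTL.loss_mem_Icc ρ q.1 q.2 z) hN hδ0 hδ1).trans ?_
  have : IsProbabilityMeasure (QTL.dataLaw P N) := by
    unfold QTL.dataLaw
    infer_instance
  refine measureReal_mono fun D hD θhat Mhat hERM => ?_
  have hjoint : QTL.jointExcessRisk P ρ θhat Mhat
      ≤ 2 * QTL.rademacherJoint P N ρ / √N + √(2 / N * Real.log (2 / δ)) := by
    -- The iterated infimum over `θ`, then `M`, becomes one over pairs, the form in which the
    -- general bound applies.
    rw [QTL.jointExcessRisk, ← QTL.iInf_expectedRisk]
    refine hD (θhat, Mhat) fun q => ?_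
    have h := hERM.trainingLoss_le ρ q.1 q.2
    rwa [QTL.trainingLoss, QTL.trainingLoss, div_le_div_iff_of_pos_right hN'] at h
  have hmono : 2 * QTL.rademacherJoint P N ρ / √N
      ≤ 2 * (QTL.rademacherJoint P N ρ + QTL.rademacherPOVM P N ρ) / √N :=
    div_le_div_of_nonneg_right (by linarith [QTL.rademacherPOVM_nonneg ρ P N])
      (Real.sqrt_nonneg _)
  have hfinal := hjoint.trans (add_le_add hmono le_rfl)
  exact ⟨(QTL.excessRisk_le_jointExcessRisk ρ P θhat Mhat).trans hfinal, hfinal⟩
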